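/- Let $\mathfrak A$ and $A$ be $C^*$-algebras (not necessarily unital), and let $\mathfrak A$ act on $A$ compatibly. This means that there are bilinear maps $(\alpha,a)\mapsto\alpha\cdot a$ and $(a,\alpha)\mapsto a\cdot\alpha$ and a constant $k>0$ with $\|\alpha\cdot a\|,\|a\cdot\alpha\|\le k\|a\|\|\alpha\|$, $\alpha\cdot(ab)=(\alpha\cdot a)b$, $(ab)\cdot\alpha=a(b\cdot\alpha)$, $(\alpha\cdot a)^*=a^*\cdot\alpha^*$ and $(a\cdot\alpha)^*=\alpha^*\cdot a^*$ for all $\alpha\in\mathfrak A$, $a,b\in A$. (This includes all $\mathfrak A$-bimodules with compatible actions; the associativity laws of a bimodule are not needed.) For $C^*$-algebras $A,B$ with compatible actions of $\mathfrak A$ let $A\odot B$ be the algebraic tensor product, let $\|\cdot\|_{\max}$ be the maximal $C^*$-norm on it, and let $I_{A,B}$ be the two-sided ideal of $A\odot B$ generated by all $a\cdot\alpha\otimes b-a\otimes\alpha\cdot b$. Let $A\otimes_{\mathfrak A,\max}B$ be the $C^*$-algebra obtained by completing (and separating) $A\odot_{\mathfrak A}B:=(A\odot B)/I_{A,B}$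 in the quotient seminorm $\|x+I_{A,B}\|=\inf_{i\in I_{A,B}}\|x+i\|_{\max}$. For a $C^*$-subalgebra $D\subseteq A$ that is stable under both actions of $\mathfrak A$, the inclusion $D\subseteq A$ is called $\mathfrak A$-max-injective if for every $C^*$-algebra $C$ with a compatible action of $\mathfrak A$ and every $x\in D\odot C$ the norm of the class of $x$ in $D\otimes_{\mathfrak A,\max}C$ equals the norm of its class in $A\otimes_{\mathfrak A,\max}C$. Let $N$ be a closed two-sided ideal of $A$; it is automatically stable under both actions, and it carries the restricted actions. Then for every $C^*$-algebra $B$ with a compatible action of $\mathfrak A$ there is an isometric $*$-homomorphism $$N\otimes_{\mathfrak A,\max}B\longrightarrow A\otimes_{\mathfrak A,\max}B$$ which maps the class of $n\otimes b$ to the class of $n\otimes b$ for all $n\in N$, $b\in B$. Consequently, the inclusion $N\subseteq A$ is $\mathfrak A$-max-injective. -/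

import Mathlib

open scoped TensorProduct

universe u v w

noncomputable section

namespace ModuleTensor

/-- A pair of `*`-representations of `A` and `B` with commuting ranges on one Hilbert space. -/
structure CommutingRep (A : Type u) (B : Type v) [NonUnitalCStarAlgebra A]
    [NonUnitalCStarAlgebra B] where
  H : Type (max u v)
  [normedAddCommGroup : NormedAddCommGroup H]
  [innerProductSpace : InnerProductSpace ℂ H]
  [completeSpace : CompleteSpace H]
  repA : A →⋆ₙₐ[ℂ] (H →L[ℂ] H)
  repB : B →⋆ₙₐ[ℂ] (H →L[ℂ] H)
  commute : ∀ a b, repA a * repB b = repB b * repA a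

attribute [instance] CommutingRep.normedAddCommGroup CommutingRep.innerProductSpace
  CommutingRep.completeSpace

section MaxNorm

variable {A : Type u} {B : Type v} [NonUnitalCStarAlgebra A] [NonUnitalCStarAlgebra B]

/-- The linear map `A ⊙ B → B(H)`, `a ⊗ b ↦ π(a) σ(b)`, of a commuting pair `(π, σ)`. -/
def CommutingRep.prod (R : CommutingRep A B) : A ⊗[ℂ] B →ₗ[ℂ] (R.H →L[ℂ] R.H) :=
  TensorProduct.lift ((LinearMap.mul ℂ (R.H →L[ℂ] R.H)).compl₁₂
    (R.repA : A →ₗ[ℂ] (R.H →L[ℂ] R.H)) (R.repB : B →ₗ[ℂ] (R.H →L[ℂ] R.H)))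

@[simp]
lemma CommutingRep.prod_tmul (R : CommutingRep A B) (a : A) (b : B) :
    R.prod (a ⊗ₜ b) = R.repA a * R.repB b := rfl

lemma CommutingRep.prod_mul (R : CommutingRep A B) (x y : A ⊗[ℂ] B) :
    R.prod (x * y) = R.prod x * R.prod y := by
  induction x with
  | zero => simp
  | add x₁ x₂ h₁ h₂ => rw [add_mul, map_add, h₁, h₂, map_add, add_mul]
  | tmul a b =>
    induction y with
    | zero => simp
    | add y₁ y₂ h₁ h₂ => rw [mul_add, map_add, h₁, h₂, map_add, mul_add]
    | tmul c d =>
      rw [Algebra.TensorProduct.tmul_mul_tmul, prod_tmul, prod_tmul, prod_tmul, map_mul, map_mul,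
        mul_assoc, mul_assoc, ← mul_assoc (R.repA c), R.commute, mul_assoc]

lemma CommutingRep.prod_star (R : CommutingRep A B) (x : A ⊗[ℂ] B) :
    R.prod (star x) = star (R.prod x) := by
  induction x with
  | zero => simp
  | add x₁ x₂ h₁ h₂ => rw [star_add, map_add, h₁, h₂, map_add, star_add]
  | tmul a b =>
    rw [TensorProduct.star_tmul, prod_tmul, prod_tmul, star_mul, map_star, map_star, ← map_star,
      ← map_star, R.commute]

lemma CommutingRep.exists_bound (x : A ⊗[ℂ] B) :
    ∃ M : ℝ, ∀ R : CommutingRep A B, ‖R.prod x‖ ≤ M := by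
  induction x with
  | zero => exact ⟨0, fun R => by simp⟩
  | add x₁ x₂ h₁ h₂ =>
    obtain ⟨M₁, h₁⟩ := h₁
    obtain ⟨M₂, h₂⟩ := h₂
    exact ⟨M₁ + M₂, fun R => by
      rw [map_add]; exact (norm_add_le _ _).trans (add_le_add (h₁ R) (h₂ R))⟩
  | tmul a b =>
    refine ⟨‖a‖ * ‖b‖, fun R => ?_⟩
    rw [prod_tmul]
    exact (norm_mul_le _ _).trans (mul_le_mul (NonUnitalStarAlgHom.norm_apply_le _ _)
      (NonUnitalStarAlgHom.norm_apply_le _ _) (norm_nonneg _) (norm_nonneg _))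

instance : Nonempty (CommutingRep A B) :=
  ⟨{ H := PUnit, repA := 0, repB := 0, commute := fun _ _ => rfl }⟩

/-- The maximal `C*`-norm on `A ⊙ B`: the supremum of `‖∑ π(aᵢ) σ(bᵢ)‖` over all commuting
pairs `(π, σ)` of `*`-representations. -/
def maxNorm (x : A ⊗[ℂ] B) : ℝ := ⨆ R : CommutingRep A B, ‖R.prod x‖

lemma maxNorm_bddAbove (x : A ⊗[ℂ] B) :
    BddAbove (Set.range fun R : CommutingRep A B => ‖R.prod x‖) := by
  obtain ⟨M, hM⟩ := CommutingRep.exists_bound x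
  exact ⟨M, by rintro _ ⟨R, rfl⟩; exact hM R⟩

lemma le_maxNorm (R : CommutingRep A B) (x : A ⊗[ℂ] B) : ‖R.prod x‖ ≤ maxNorm x :=
  le_ciSup (maxNorm_bddAbove x) R

lemma maxNorm_le {x : A ⊗[ℂ] B} {M : ℝ} (h : ∀ R : CommutingRep A B, ‖R.prod x‖ ≤ M) :
    maxNorm x ≤ M := ciSup_le h

lemma maxNorm_nonneg (x : A ⊗[ℂ] B) : 0 ≤ maxNorm x :=
  Real.iSup_nonneg fun _ => norm_nonneg _

/-- The algebraic tensor product `A ⊙ B`, carrying the maximal norm. -/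
def PreMax (A : Type u) (B : Type v) [NonUnitalCStarAlgebra A] [NonUnitalCStarAlgebra B] :
    Type (max u v) := A ⊗[ℂ] B

instance : NonUnitalRing (PreMax A B) := inferInstanceAs (NonUnitalRing (A ⊗[ℂ] B))
instance : Module ℂ (PreMax A B) := inferInstanceAs (Module ℂ (A ⊗[ℂ] B))
instance : IsScalarTower ℂ (PreMax A B) (PreMax A B) :=
  inferInstanceAs (IsScalarTower ℂ (A ⊗[ℂ] B) (A ⊗[ℂ] B))
instance : SMulCommClass ℂ (PreMax A B) (PreMax A B) :=
  inferInstanceAs (SMulCommClass ℂ (A ⊗[ℂ] B) (A ⊗[ℂ] B))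

instance : StarAddMonoid (PreMax A B) := inferInstanceAs (StarAddMonoid (A ⊗[ℂ] B))
instance : StarModule ℂ (PreMax A B) := inferInstanceAs (StarModule ℂ (A ⊗[ℂ] B))

instance : StarRing (PreMax A B) where
  star_add := star_add
  star_mul := fun x y : A ⊗[ℂ] B => by
    change star (x * y) = star y * star x
    induction x with
    | zero => simp
    | add x₁ x₂ h₁ h₂ => rw [add_mul, star_add, h₁, h₂, star_add, mul_add]
    | tmul a b =>
      induction y with
      | zero => simp
      | add y₁ y₂ h₁ h₂ => rw [mul_add, star_add, h₁, h₂, star_add, add_mul]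
      | tmul c d => simp

lemma maxNorm_add_le (x y : A ⊗[ℂ] B) : maxNorm (x + y) ≤ maxNorm x + maxNorm y :=
  maxNorm_le fun R => by
    rw [map_add]
    exact (norm_add_le _ _).trans (add_le_add (le_maxNorm R x) (le_maxNorm R y))

lemma maxNorm_mul_le (x y : A ⊗[ℂ] B) : maxNorm (x * y) ≤ maxNorm x * maxNorm y :=
  maxNorm_le fun R => by
    rw [R.prod_mul]
    exact (norm_mul_le _ _).trans (mul_le_mul (le_maxNorm R x) (le_maxNorm R y)
      (norm_nonneg _) (maxNorm_nonneg x))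

lemma maxNorm_smul_le (c : ℂ) (x : A ⊗[ℂ] B) : maxNorm (c • x) ≤ ‖c‖ * maxNorm x :=
  maxNorm_le fun R => by
    rw [map_smul, norm_smul]
    exact mul_le_mul_of_nonneg_left (le_maxNorm R x) (norm_nonneg c)

lemma mul_self_maxNorm_le (x : A ⊗[ℂ] B) : maxNorm x * maxNorm x ≤ maxNorm (star x * x) := by
  have h : maxNorm x ≤ Real.sqrt (maxNorm (star x * x)) := maxNorm_le fun R => by
    refine Real.le_sqrt_of_sq_le ?_
    rw [sq, ← CStarRing.norm_star_mul_self, ← R.prod_star, ← R.prod_mul]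
    exact le_maxNorm R _
  calc maxNorm x * maxNorm x
      ≤ Real.sqrt (maxNorm (star x * x)) * Real.sqrt (maxNorm (star x * x)) :=
        mul_le_mul h h (maxNorm_nonneg x) (Real.sqrt_nonneg _)
    _ = _ := Real.mul_self_sqrt (maxNorm_nonneg _)

instance : SeminormedAddCommGroup (PreMax A B) :=
  AddGroupSeminorm.toSeminormedAddCommGroup
    { toFun := fun x : A ⊗[ℂ] B => maxNorm x
      map_zero' := le_antisymm (maxNorm_le fun R => (norm_eq_zero.mpr (map_zero R.prod)).le) (maxNorm_nonneg _)
      neg' := fun x : A ⊗[ℂ] B => by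
        change maxNorm (-x) = maxNorm x
        simp only [maxNorm, map_neg, norm_neg]
      add_le' := maxNorm_add_le }

instance : NonUnitalSeminormedRing (PreMax A B) :=
  { (inferInstance : SeminormedAddCommGroup (PreMax A B)),
    (inferInstance : NonUnitalRing (PreMax A B)) with
    norm_mul_le := maxNorm_mul_le }

instance : NormedSpace ℂ (PreMax A B) where
  norm_smul_le := maxNorm_smul_le

lemma PreMax.mul_self_norm_le (x : PreMax A B) : ‖x‖ * ‖x‖ ≤ ‖star x * x‖ :=
  mul_self_maxNorm_le _

/-- The identity map from `A ⊙ B` to its copy carrying the maximal norm. -/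
def PreMax.of : (A ⊗[ℂ] B) ≃ₗ[ℂ] PreMax A B := LinearEquiv.refl ℂ _

end MaxNorm

section Completion
open UniformSpace UniformSpace.Completion

/-- The completion of a pre-`C*`-algebra `X`. -/
def CStarCompletion (X : Type u) [NonUnitalSeminormedRing X] : Type u := Completion X

variable {X : Type u} [NonUnitalSeminormedRing X]

instance : NormedAddCommGroup (CStarCompletion X) :=
  inferInstanceAs (NormedAddCommGroup (Completion X))
instance : CompleteSpace (CStarCompletion X) :=
  inferInstanceAs (CompleteSpace (Completion X))
instance [NormedSpace ℂ X] : NormedSpace ℂ (CStarCompletion X) :=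
  inferInstanceAs (NormedSpace ℂ (Completion X))

/-- The canonical map of `X` into its completion. -/
def CStarCompletion.of : X →+ CStarCompletion X := toCompl

namespace CStarCompletion

lemma norm_of (x : X) : ‖of x‖ = ‖x‖ := Completion.norm_coe x

lemma isDenseInducing_of : IsDenseInducing (of : X → CStarCompletion X) :=
  Completion.isDenseInducing_coe

lemma continuous_of : Continuous (of : X → CStarCompletion X) := Completion.continuous_coe X

lemma denseRange_of : DenseRange (of : X → CStarCompletion X) := isDenseInducing_of.dense

lemma of_smul [NormedSpace ℂ X] (c : ℂ) (x : X) : of (c • x) = c • of x :=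
  Completion.coe_smul c x

instance : Mul (CStarCompletion X) :=
  ⟨Function.curry <| (isDenseInducing_of.prodMap isDenseInducing_of).extend
    (of ∘ Function.uncurry (· * ·))⟩

lemma of_mul (x y : X) : of (x * y) = of x * of y :=
  ((isDenseInducing_of.prodMap isDenseInducing_of).extend_eq
    (continuous_of.comp continuous_mul) (x, y)).symm

instance : ContinuousMul (CStarCompletion X) where
  continuous_mul := by
    let m := (AddMonoidHom.mul : X →+ X →+ X).compr₂ of
    have : Continuous fun p : X × X => m p.1 p.2 := continuous_of.comp continuous_mul
    have di : IsDenseInducing (of : X → CStarCompletion X) := isDenseInducing_of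
    exact (di.extend_Z_bilin di this :)

@[elab_as_elim]
lemma ind {p : CStarCompletion X → Prop} (x : CStarCompletion X) (hp : IsClosed {x | p x})
    (h : ∀ x : X, p (of x)) : p x := Completion.induction_on x hp h

@[elab_as_elim]
lemma ind₂ {p : CStarCompletion X → CStarCompletion X → Prop} (x y : CStarCompletion X)
    (hp : IsClosed {z : CStarCompletion X × CStarCompletion X | p z.1 z.2})
    (h : ∀ x y : X, p (of x) (of y)) : p x y := Completion.induction_on₂ x y hp h

@[elab_as_elim]
lemma ind₃ {p : CStarCompletion X → CStarCompletion X → CStarCompletion X → Prop}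
    (x y z : CStarCompletion X)
    (hp : IsClosed {z : CStarCompletion X × CStarCompletion X × CStarCompletion X |
      p z.1 z.2.1 z.2.2})
    (h : ∀ x y z : X, p (of x) (of y) (of z)) : p x y z := Completion.induction_on₃ x y z hp h

instance : NonUnitalNormedRing (CStarCompletion X) :=
  { (inferInstance : NormedAddCommGroup (CStarCompletion X)),
    (inferInstance : Mul (CStarCompletion X)) with
    zero_mul := fun a => ind a (isClosed_eq (by fun_prop) continuous_const) fun a => by
      rw [← map_zero of, ← of_mul, zero_mul]
    mul_zero := fun a => ind a (isClosed_eq (by fun_prop) continuous_const) fun a => by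
      rw [← map_zero of, ← of_mul, mul_zero]
    mul_assoc := fun a b c => ind₃ a b c (isClosed_eq (by fun_prop) (by fun_prop))
      fun a b c => by simp only [← of_mul, mul_assoc]
    left_distrib := fun a b c => ind₃ a b c (isClosed_eq (by fun_prop) (by fun_prop))
      fun a b c => by simp only [← of_mul, ← map_add, mul_add]
    right_distrib := fun a b c => ind₃ a b c (isClosed_eq (by fun_prop) (by fun_prop))
      fun a b c => by simp only [← of_mul, ← map_add, add_mul]
    norm_mul_le := fun a b => ind₂ a b (isClosed_le (by fun_prop) (by fun_prop)) fun a b => by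
      simpa only [← of_mul, norm_of] using norm_mul_le a b }

section Smul

variable [NormedSpace ℂ X]

instance [IsScalarTower ℂ X X] : IsScalarTower ℂ (CStarCompletion X) (CStarCompletion X) where
  smul_assoc c a b := by
    change c • a * b = c • (a * b)
    refine ind₂ a b (isClosed_eq ((continuous_fst.const_smul c).mul continuous_snd)
      ((continuous_fst.mul continuous_snd).const_smul c)) fun a b => ?_
    rw [← of_smul, ← of_mul, ← of_mul, ← of_smul, smul_mul_assoc]

instance [SMulCommClass ℂ X X] : SMulCommClass ℂ (CStarCompletion X) (CStarCompletion X) where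
  smul_comm c a b := by
    change c • (a * b) = a * c • b
    refine ind₂ a b (isClosed_eq ((continuous_fst.mul continuous_snd).const_smul c)
      (continuous_fst.mul (continuous_snd.const_smul c))) fun a b => ?_
    rw [← of_smul, ← of_mul, ← of_mul, ← of_smul, mul_smul_comm]

end Smul

variable [StarRing X]

/-- The involution on the completion, extended by continuity from `X`. -/
def starHom (X : Type u) [NonUnitalSeminormedRing X] [StarRing X] [NormedStarGroup X] :
    CStarCompletion X →+ CStarCompletion X :=
  (starAddEquiv : X ≃+ X).toAddMonoidHom.completion continuous_star

variable [NormedStarGroup X]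

instance : Star (CStarCompletion X) := ⟨starHom X⟩

lemma continuous_starC : Continuous (star : CStarCompletion X → CStarCompletion X) :=
  AddMonoidHom.continuous_completion _ _

lemma of_star (x : X) : of (star x) = star (of x) :=
  (AddMonoidHom.completion_coe (starAddEquiv : X ≃+ X).toAddMonoidHom continuous_star x).symm

instance : StarRing (CStarCompletion X) where
  star_involutive a := by
    refine ind a (isClosed_eq (continuous_starC.comp continuous_starC) continuous_id) fun a => ?_
    rw [← of_star, ← of_star, star_star]
  star_add := map_add (starHom X)
  star_mul a b := by
    refine ind₂ a b (isClosed_eq (continuous_starC.comp continuous_mul)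
      ((continuous_starC.comp continuous_snd).mul (continuous_starC.comp continuous_fst)))
      fun a b => ?_
    rw [← of_mul, ← of_star, ← of_star, ← of_star, ← of_mul, star_mul]

instance [NormedSpace ℂ X] [StarModule ℂ X] : StarModule ℂ (CStarCompletion X) where
  star_smul c a := by
    refine ind a (isClosed_eq (continuous_starC.comp (continuous_const_smul c))
      (continuous_starC.const_smul (star c))) fun a => ?_
    rw [← of_smul, ← of_star, ← of_star, ← of_smul, star_smul]

lemma norm_mul_self_le_of (hX : ∀ x : X, ‖x‖ * ‖x‖ ≤ ‖star x * x‖) (a : CStarCompletion X) :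
    ‖a‖ * ‖a‖ ≤ ‖star a * a‖ := by
  refine ind a (isClosed_le (by fun_prop) (continuous_norm.comp
    (continuous_starC.mul continuous_id))) fun a => ?_
  rw [← of_star, ← of_mul, norm_of, norm_of]
  exact hX a

end CStarCompletion
end Completion

section Quotient

variable {C : Type u} [NonUnitalCStarAlgebra C]

/-- A closed two-sided ideal of a `C*`-algebra, as a property of a linear subspace. -/
class IsClosedIdeal (J : Submodule ℂ C) : Prop where
  isClosed : IsClosed (J : Set C)
  mul_mem_left : ∀ c : C, ∀ x ∈ J, c * x ∈ J
  mul_mem_right : ∀ x ∈ J, ∀ c : C, x * c ∈ J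

open Filter Topology

/-- A `C*`-algebra has an approximate unit of positive contractions. -/
lemma exists_approxUnit (C : Type u) [NonUnitalCStarAlgebra C] :
    ∃ l : Filter C, l.NeBot ∧ (∀ x, Tendsto (fun e => e * x) l (𝓝 x)) ∧
      (∀ x, Tendsto (fun e => x * e) l (𝓝 x)) ∧ ∀ᶠ e in l, (∃ s, e = star s * s) ∧ ‖e‖ ≤ 1 := by
  let _ := CStarAlgebra.spectralOrder C
  have _ := CStarAlgebra.spectralOrderedRing C
  have h := CStarAlgebra.increasingApproximateUnit C
  refine ⟨_, h.neBot, h.tendsto_mul_right, h.tendsto_mul_left, ?_⟩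
  filter_upwards [h.eventually_nonneg, h.eventually_norm] with e h0 h1
  exact ⟨CStarAlgebra.nonneg_iff_eq_star_mul_self.mp h0, h1⟩

lemma norm_sub_mul_le {e : C} (h0 : ∃ s, e = star s * s) (h1 : ‖e‖ ≤ 1) (z : C) :
    ‖z - e * z‖ ≤ ‖z‖ := by
  let _ := CStarAlgebra.spectralOrder C
  have _ := CStarAlgebra.spectralOrderedRing C
  have he : 0 ≤ e := CStarAlgebra.nonneg_iff_eq_star_mul_self.mpr h0
  refine CStarAlgebra.norm_sub_mul_self_le_of_inr z le_rfl he h1 (norm_nonneg z) ?_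
  rw [Unitization.inr_zero, sub_zero, mul_one, CStarRing.norm_star_mul_self,
    Unitization.norm_inr, sq]

lemma norm_sub_mul_le' {e : C} (h0 : ∃ s, e = star s * s) (h1 : ‖e‖ ≤ 1) (z : C) :
    ‖z - z * e‖ ≤ ‖z‖ := by
  have he : star e = e := by obtain ⟨s, rfl⟩ := h0; simp
  have := norm_sub_mul_le h0 h1 (star z)
  rwa [← norm_star, star_sub, star_mul, star_star, he, norm_star] at this

/-- The largest `*`-subalgebra in a closed ideal; by `mem_idealCore` it is all of the ideal. -/
def idealCore (J : Submodule ℂ C) [hJ : IsClosedIdeal J] : NonUnitalStarSubalgebra ℂ C where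
  carrier := {x | x ∈ J ∧ star x ∈ J}
  add_mem' hx hy := ⟨J.add_mem hx.1 hy.1, by rw [star_add]; exact J.add_mem hx.2 hy.2⟩
  zero_mem' := ⟨J.zero_mem, by simp⟩
  mul_mem' {x y} hx hy := ⟨hJ.mul_mem_left _ _ hy.1, by
    rw [star_mul]; exact hJ.mul_mem_left _ _ hx.2⟩
  smul_mem' c x hx := ⟨J.smul_mem c hx.1, by rw [star_smul]; exact J.smul_mem _ hx.2⟩
  star_mem' hx := ⟨hx.2, by simpa using hx.1⟩

instance (J : Submodule ℂ C) [hJ : IsClosedIdeal J] : IsClosed (idealCore J : Set C) :=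
  hJ.isClosed.inter (hJ.isClosed.preimage continuous_star)

lemma exists_approxUnit_core (J : Submodule ℂ C) [hJ : IsClosedIdeal J] :
    ∃ l : Filter C, l.NeBot ∧ (∀ᶠ e in l, e ∈ J ∧ (∃ s, e = star s * s) ∧ ‖e‖ ≤ 1) ∧
      (∀ x ∈ idealCore J, Tendsto (fun e => e * x) l (𝓝 x)) ∧
      (∀ x ∈ idealCore J, Tendsto (fun e => x * e) l (𝓝 x)) := by
  obtain ⟨l, hl, h1, h2, h3⟩ := exists_approxUnit (idealCore J)
  refine ⟨l.map Subtype.val, hl.map _, ?_, fun x hx => ?_, fun x hx => ?_⟩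
  · rw [eventually_map]
    filter_upwards [h3] with e he
    obtain ⟨⟨s, rfl⟩, h⟩ := he
    exact ⟨(star s * s).2.1, ⟨s, rfl⟩, h⟩
  · exact tendsto_map'_iff.mpr ((continuous_subtype_val.tendsto _).comp (h1 ⟨x, hx⟩))
  · exact tendsto_map'_iff.mpr ((continuous_subtype_val.tendsto _).comp (h2 ⟨x, hx⟩))

lemma IsClosedIdeal.star_mem (J : Submodule ℂ C) [hJ : IsClosedIdeal J] {x : C} (hx : x ∈ J) :
    star x ∈ J := by
  obtain ⟨l, hl, h1, -, h2⟩ := exists_approxUnit_core J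
  have hxx : star x * x ∈ idealCore J := by
    refine ⟨hJ.mul_mem_left _ _ hx, ?_⟩
    rw [star_mul, star_star]
    exact hJ.mul_mem_left _ _ hx
  have hlim : Tendsto (fun e => star x * x - star x * x * e) l (𝓝 0) := by
    simpa using (tendsto_const_nhds (x := star x * x)).sub (h2 _ hxx)
  have hlim' : Tendsto (fun e => e * star x) l (𝓝 (star x)) := by
    rw [tendsto_iff_norm_sub_tendsto_zero]
    have hs : Tendsto (fun e => Real.sqrt ‖star x * x - star x * x * e‖) l (𝓝 0) := by
      simpa using hlim.norm.sqrt
    refine squeeze_zero' (Eventually.of_forall fun _ => norm_nonneg _) ?_ hs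
    filter_upwards [h1] with e he
    have hse : star e = e := by obtain ⟨-, ⟨s, rfl⟩, -⟩ := he; simp
    refine Real.le_sqrt_of_sq_le ?_
    have : (e * star x - star x) * star (e * star x - star x) =
        (star x * x - star x * x * e) - e * (star x * x - star x * x * e) := by
      simp only [star_sub, star_mul, star_star, hse]
      noncomm_ring
    rw [sq, ← CStarRing.norm_self_mul_star, this]
    exact norm_sub_mul_le he.2.1 he.2.2 _
  refine hJ.isClosed.mem_of_tendsto hlim' ?_
  filter_upwards [h1] with e he
  exact hJ.mul_mem_right _ he.1 _

lemma mem_idealCore (J : Submodule ℂ C) [IsClosedIdeal J] {x : C} : x ∈ idealCore J ↔ x ∈ J :=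
  ⟨fun h => h.1, fun h => ⟨h, IsClosedIdeal.star_mem J h⟩⟩

/-- The key inequality behind the `C*`-identity of the quotient norm. -/
lemma exists_norm_sub_le (J : Submodule ℂ C) [hJ : IsClosedIdeal J] (x : C) {j : C} (hj : j ∈ J)
    {ε : ℝ} (hε : 0 < ε) :
    ∃ k ∈ J, ‖x - k‖ * ‖x - k‖ ≤ ‖x * star x + j‖ + ε := by
  obtain ⟨l, hl, h1, h2, -⟩ := exists_approxUnit_core J
  have hlim : Tendsto (fun e => ‖j - e * j‖) l (𝓝 0) := by
    simpa using ((tendsto_const_nhds (x := j)).sub (h2 _ ((mem_idealCore J).mpr hj))).norm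
  obtain ⟨e, ⟨heJ, h0, hn⟩, hje⟩ := (h1.and (hlim.eventually_lt_const hε)).exists
  have hse : star e = e := by obtain ⟨s, rfl⟩ := h0; simp
  refine ⟨e * x, hJ.mul_mem_right _ heJ _, ?_⟩
  have h3 : (x - e * x) * star (x - e * x) =
      (x * star x - e * (x * star x)) - (x * star x - e * (x * star x)) * e := by
    simp only [star_sub, star_mul, hse]
    noncomm_ring
  have h4 : x * star x - e * (x * star x) =
      ((x * star x + j) - e * (x * star x + j)) - (j - e * j) := by
    noncomm_ring
  rw [← CStarRing.norm_self_mul_star, h3]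
  refine (norm_sub_mul_le' h0 hn _).trans ?_
  rw [h4]
  exact (norm_sub_le _ _).trans (add_le_add (norm_sub_mul_le h0 hn _) hje.le)

/-- The quotient `C / J` by a closed two-sided ideal. -/
def IdealQuotient (J : Submodule ℂ C) [IsClosedIdeal J] : Type u := C ⧸ J

namespace IdealQuotient

variable (J : Submodule ℂ C) [hJ : IsClosedIdeal J]

instance : NormedAddCommGroup (IdealQuotient J) :=
  have := hJ.isClosed
  inferInstanceAs (NormedAddCommGroup (C ⧸ J))
instance : NormedSpace ℂ (IdealQuotient J) :=
  inferInstanceAs (NormedSpace ℂ (C ⧸ J))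
instance : CompleteSpace (IdealQuotient J) :=
  inferInstanceAs (CompleteSpace (C ⧸ J))

/-- The quotient map `C → C / J`. -/
def mk : C →ₗ[ℂ] IdealQuotient J := J.mkQ

lemma mk_surjective : Function.Surjective (mk J) := Submodule.mkQ_surjective J

variable {J} in
lemma mk_eq_mk {x y : C} : mk J x = mk J y ↔ x - y ∈ J := Submodule.Quotient.eq J

lemma mk_eq_zero {x : C} : mk J x = 0 ↔ x ∈ J := Submodule.Quotient.mk_eq_zero J

lemma norm_mk_le (x : C) : ‖mk J x‖ ≤ ‖x‖ := Submodule.Quotient.norm_mk_le J x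

lemma norm_mk_lt (x : IdealQuotient J) {ε : ℝ} (hε : 0 < ε) :
    ∃ m : C, mk J m = x ∧ ‖m‖ < ‖x‖ + ε := Submodule.Quotient.norm_mk_lt x hε

instance : Mul (IdealQuotient J) :=
  ⟨Quotient.map₂ (· * ·) (by
    intro a b hab c d hcd
    rw [← Quotient.eq_iff_equiv] at hab hcd ⊢
    have h1 : a - b ∈ J := (Submodule.Quotient.eq J).mp hab
    have h2 : c - d ∈ J := (Submodule.Quotient.eq J).mp hcd
    refine (Submodule.Quotient.eq J).mpr ?_
    have : a * c - b * d = (a - b) * c + b * (c - d) := by noncomm_ring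
    rw [this]
    exact J.add_mem (hJ.mul_mem_right _ h1 _) (hJ.mul_mem_left _ _ h2))⟩

lemma mk_mul (x y : C) : mk J (x * y) = mk J x * mk J y := rfl

instance : NonUnitalNormedRing (IdealQuotient J) :=
  { (inferInstance : NormedAddCommGroup (IdealQuotient J)),
    (inferInstance : Mul (IdealQuotient J)) with
    zero_mul := fun a => by
      obtain ⟨a, rfl⟩ := mk_surjective J a
      rw [← map_zero (mk J), ← mk_mul, zero_mul]
    mul_zero := fun a => by
      obtain ⟨a, rfl⟩ := mk_surjective J a
      rw [← map_zero (mk J), ← mk_mul, mul_zero]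
    mul_assoc := fun a b c => by
      obtain ⟨a, rfl⟩ := mk_surjective J a
      obtain ⟨b, rfl⟩ := mk_surjective J b
      obtain ⟨c, rfl⟩ := mk_surjective J c
      simp only [← mk_mul, mul_assoc]
    left_distrib := fun a b c => by
      obtain ⟨a, rfl⟩ := mk_surjective J a
      obtain ⟨b, rfl⟩ := mk_surjective J b
      obtain ⟨c, rfl⟩ := mk_surjective J c
      simp only [← mk_mul, ← map_add, mul_add]
    right_distrib := fun a b c => by
      obtain ⟨a, rfl⟩ := mk_surjective J a
      obtain ⟨b, rfl⟩ := mk_surjective J b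
      obtain ⟨c, rfl⟩ := mk_surjective J c
      simp only [← mk_mul, ← map_add, add_mul]
    norm_mul_le := fun a b => by
      have h : ∀ ε : ℝ, 0 < ε → ‖a * b‖ ≤ (‖a‖ + ε) * (‖b‖ + ε) := fun ε hε => by
        obtain ⟨x, rfl, hx⟩ := norm_mk_lt J a hε
        obtain ⟨y, rfl, hy⟩ := norm_mk_lt J b hε
        rw [← mk_mul]
        exact (norm_mk_le J _).trans ((norm_mul_le x y).trans
          (mul_le_mul hx.le hy.le (norm_nonneg y) ((norm_nonneg x).trans hx.le)))
      have hlim : Tendsto (fun ε : ℝ => (‖a‖ + ε) * (‖b‖ + ε)) (𝓝[>] 0)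
          (𝓝 ((‖a‖ + 0) * (‖b‖ + 0))) :=
        tendsto_nhdsWithin_of_tendsto_nhds (Continuous.tendsto (by fun_prop) 0)
      rw [add_zero, add_zero] at hlim
      exact ge_of_tendsto hlim (eventually_nhdsWithin_of_forall h) }

instance : IsScalarTower ℂ (IdealQuotient J) (IdealQuotient J) where
  smul_assoc c a b := by
    obtain ⟨a, rfl⟩ := mk_surjective J a
    obtain ⟨b, rfl⟩ := mk_surjective J b
    simp only [smul_eq_mul, ← map_smul, ← mk_mul, smul_mul_assoc]

instance : SMulCommClass ℂ (IdealQuotient J) (IdealQuotient J) where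
  smul_comm c a b := by
    obtain ⟨a, rfl⟩ := mk_surjective J a
    obtain ⟨b, rfl⟩ := mk_surjective J b
    simp only [smul_eq_mul, ← map_smul, ← mk_mul, mul_smul_comm]

instance : Star (IdealQuotient J) :=
  ⟨Quotient.map star (by
    intro a b hab
    rw [← Quotient.eq_iff_equiv] at hab ⊢
    have h1 : a - b ∈ J := (Submodule.Quotient.eq J).mp hab
    refine (Submodule.Quotient.eq J).mpr ?_
    rw [← star_sub]
    exact hJ.star_mem J h1)⟩

lemma mk_star (x : C) : mk J (star x) = star (mk J x) := rfl

instance : StarRing (IdealQuotient J) where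
  star_involutive a := by
    obtain ⟨a, rfl⟩ := mk_surjective J a
    rw [← mk_star, ← mk_star, star_star]
  star_add a b := by
    obtain ⟨a, rfl⟩ := mk_surjective J a
    obtain ⟨b, rfl⟩ := mk_surjective J b
    simp only [← mk_star, ← map_add, star_add]
  star_mul a b := by
    obtain ⟨a, rfl⟩ := mk_surjective J a
    obtain ⟨b, rfl⟩ := mk_surjective J b
    simp only [← mk_star, ← mk_mul, star_mul]

instance : StarModule ℂ (IdealQuotient J) where
  star_smul c a := by
    obtain ⟨a, rfl⟩ := mk_surjective J a
    simp only [← mk_star, ← map_smul, star_smul]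

lemma mul_self_norm_le (a : IdealQuotient J) : ‖a‖ * ‖a‖ ≤ ‖star a * a‖ := by
  obtain ⟨x, rfl⟩ := mk_surjective J a
  have hstar : ∀ y : C, ‖mk J (star y)‖ ≤ ‖mk J y‖ := fun y => by
    refine le_of_forall_pos_le_add fun ε hε => ?_
    obtain ⟨z, hz, hlt⟩ := norm_mk_lt J (mk J y) hε
    rw [mk_star, ← hz, ← mk_star]
    refine (norm_mk_le J _).trans ?_
    rw [norm_star, hz]
    exact hlt.le
  refine le_of_forall_pos_le_add fun ε hε => ?_
  obtain ⟨z, hz, hlt⟩ := norm_mk_lt J (star (mk J x) * mk J x) (half_pos hε)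
  have hj : z - star x * star (star x) ∈ J := by
    rw [star_star]; exact mk_eq_mk.mp hz
  obtain ⟨k, hk, hle⟩ := exists_norm_sub_le J (star x) hj (half_pos hε)
  rw [add_sub_cancel] at hle
  have h1 : ‖mk J x‖ ≤ ‖star x - k‖ := by
    have h2 : mk J (star x) = mk J (star x - k) := mk_eq_mk.mpr (by simpa using hk)
    have h3 := hstar (star x)
    rw [star_star, h2] at h3
    exact h3.trans (norm_mk_le J _)
  calc ‖mk J x‖ * ‖mk J x‖ ≤ ‖star x - k‖ * ‖star x - k‖ :=
        mul_le_mul h1 h1 (norm_nonneg _) (norm_nonneg _)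
    _ ≤ ‖z‖ + ε / 2 := hle
    _ ≤ _ := by linarith

instance : CStarRing (IdealQuotient J) := ⟨mul_self_norm_le J⟩

instance : NonUnitalCStarAlgebra (IdealQuotient J) where

end IdealQuotient

end Quotient
section MaxTensor

variable {A : Type u} {B : Type v} [NonUnitalCStarAlgebra A] [NonUnitalCStarAlgebra B]

instance : NormedStarGroup (PreMax A B) where
  norm_star_le := fun x : A ⊗[ℂ] B => maxNorm_le fun R => by
    exact (le_of_eq ((congrArg norm (R.prod_star x)).trans (norm_star _))).trans (le_maxNorm R x)

/-- The maximal tensor product `A ⊗_max B`: the completion of `A ⊙ B` in the maximal norm. -/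
def MaxTensor (A : Type u) (B : Type v) [NonUnitalCStarAlgebra A] [NonUnitalCStarAlgebra B] :
    Type (max u v) := CStarCompletion (PreMax A B)

instance : NonUnitalNormedRing (MaxTensor A B) :=
  inferInstanceAs (NonUnitalNormedRing (CStarCompletion (PreMax A B)))
instance : StarRing (MaxTensor A B) :=
  inferInstanceAs (StarRing (CStarCompletion (PreMax A B)))
instance : CompleteSpace (MaxTensor A B) :=
  inferInstanceAs (CompleteSpace (CStarCompletion (PreMax A B)))
instance : CStarRing (MaxTensor A B) :=
  ⟨CStarCompletion.norm_mul_self_le_of PreMax.mul_self_norm_le⟩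
instance : NormedSpace ℂ (MaxTensor A B) :=
  inferInstanceAs (NormedSpace ℂ (CStarCompletion (PreMax A B)))
instance : IsScalarTower ℂ (MaxTensor A B) (MaxTensor A B) :=
  inferInstanceAs (IsScalarTower ℂ (CStarCompletion (PreMax A B)) (CStarCompletion (PreMax A B)))
instance : SMulCommClass ℂ (MaxTensor A B) (MaxTensor A B) :=
  inferInstanceAs (SMulCommClass ℂ (CStarCompletion (PreMax A B)) (CStarCompletion (PreMax A B)))
instance : StarModule ℂ (MaxTensor A B) :=
  inferInstanceAs (StarModule ℂ (CStarCompletion (PreMax A B)))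

instance : NonUnitalCStarAlgebra (MaxTensor A B) where

/-- The canonical map `A ⊙ B → A ⊗_max B`. -/
def MaxTensor.of : A ⊗[ℂ] B →ₗ[ℂ] MaxTensor A B where
  toFun x := CStarCompletion.of (PreMax.of x)
  map_add' x y := map_add CStarCompletion.of (PreMax.of x) (PreMax.of y)
  map_smul' c x := CStarCompletion.of_smul c (PreMax.of x)

lemma MaxTensor.norm_of (x : A ⊗[ℂ] B) : ‖MaxTensor.of x‖ = maxNorm x :=
  CStarCompletion.norm_of (PreMax.of x)

lemma MaxTensor.denseRange_of : DenseRange (MaxTensor.of : A ⊗[ℂ] B → MaxTensor A B) :=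
  CStarCompletion.denseRange_of (X := PreMax A B)

lemma MaxTensor.of_mul (x y : A ⊗[ℂ] B) :
    MaxTensor.of (x * y) = MaxTensor.of x * MaxTensor.of y :=
  CStarCompletion.of_mul (PreMax.of x) (PreMax.of y)

lemma MaxTensor.of_star (x : A ⊗[ℂ] B) : MaxTensor.of (star x) = star (MaxTensor.of x) :=
  CStarCompletion.of_star (PreMax.of x)

end MaxTensor

section Action

/-- A compatible action of the `C*`-algebra `𝔄` on the `C*`-algebra `A`: `lact α a` is `α · a`
and `ract α a` is `a · α`. The associativity laws of a bimodule are not needed and not demanded;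
every `𝔄`-bimodule with compatible actions is an instance. -/
structure CompatibleAction (𝔄 : Type w) (A : Type u) [NonUnitalCStarAlgebra 𝔄]
    [NonUnitalCStarAlgebra A] where
  lact : 𝔄 →ₗ[ℂ] A →ₗ[ℂ] A
  ract : 𝔄 →ₗ[ℂ] A →ₗ[ℂ] A
  bounded : ∃ k : ℝ, 0 < k ∧ ∀ α a, ‖ract α a‖ ≤ k * ‖a‖ * ‖α‖ ∧ ‖lact α a‖ ≤ k * ‖a‖ * ‖α‖
  lact_mul : ∀ α a b, lact α (a * b) = lact α a * b
  ract_mul : ∀ α a b, ract α (a * b) = a * ract α b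
  star_lact : ∀ α a, star (lact α a) = ract (star α) (star a)
  star_ract : ∀ α a, star (ract α a) = lact (star α) (star a)

variable {𝔄 : Type w} {A : Type u} [NonUnitalCStarAlgebra 𝔄] [NonUnitalCStarAlgebra A]

/-- `D` is stable under both actions of `𝔄`. -/
def CompatibleAction.Invariant (ρ : CompatibleAction 𝔄 A) (D : NonUnitalStarSubalgebra ℂ A) :
    Prop := ∀ α : 𝔄, ∀ d ∈ D, ρ.lact α d ∈ D ∧ ρ.ract α d ∈ D

/-- The restriction of a compatible action to a stable `C*`-subalgebra. -/
def CompatibleAction.restrict (ρ : CompatibleAction 𝔄 A) (D : NonUnitalStarSubalgebra ℂ A)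
    [IsClosed (D : Set A)] (hD : ρ.Invariant D) : CompatibleAction 𝔄 D where
  lact := LinearMap.mk₂ ℂ (fun α d => (⟨ρ.lact α d, (hD α d d.2).1⟩ : D))
    (fun _ _ _ => Subtype.ext (by simp)) (fun _ _ _ => Subtype.ext (by simp))
    (fun _ _ _ => Subtype.ext (by simp)) (fun _ _ _ => Subtype.ext (by simp))
  ract := LinearMap.mk₂ ℂ (fun α d => (⟨ρ.ract α d, (hD α d d.2).2⟩ : D))
    (fun _ _ _ => Subtype.ext (by simp)) (fun _ _ _ => Subtype.ext (by simp))
    (fun _ _ _ => Subtype.ext (by simp)) (fun _ _ _ => Subtype.ext (by simp))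
  bounded := by
    obtain ⟨k, hk, h⟩ := ρ.bounded
    exact ⟨k, hk, fun α d => h α d⟩
  lact_mul α a b := Subtype.ext (ρ.lact_mul α a b)
  ract_mul α a b := Subtype.ext (ρ.ract_mul α a b)
  star_lact α a := Subtype.ext (ρ.star_lact α a)
  star_ract α a := Subtype.ext (ρ.star_ract α a)

/-- A closed two-sided ideal as a `C*`-subalgebra. -/
def idealSubalgebra (N : Submodule ℂ A) [hN : IsClosedIdeal N] : NonUnitalStarSubalgebra ℂ A where
  carrier := N
  add_mem' := N.add_mem
  zero_mem' := N.zero_mem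
  mul_mem' {x y} _ hy := hN.mul_mem_left x y hy
  smul_mem' c _ hx := N.smul_mem c hx
  star_mem' hx := IsClosedIdeal.star_mem N hx

instance (N : Submodule ℂ A) [hN : IsClosedIdeal N] : IsClosed (idealSubalgebra N : Set A) :=
  hN.isClosed

/-- Closed two-sided ideals are automatically stable under a compatible action. -/
lemma CompatibleAction.invariant_ideal (ρ : CompatibleAction 𝔄 A) (N : Submodule ℂ A)
    [hN : IsClosedIdeal N] : ρ.Invariant (idealSubalgebra N) := by
  intro α n hn
  obtain ⟨k, hk, hb⟩ := ρ.bounded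
  have hl : Continuous (ρ.lact α) := AddMonoidHomClass.continuous_of_bound (ρ.lact α) (k * ‖α‖)
    fun a => (hb α a).2.trans (by rw [mul_right_comm])
  have hr : Continuous (ρ.ract α) := AddMonoidHomClass.continuous_of_bound (ρ.ract α) (k * ‖α‖)
    fun a => (hb α a).1.trans (by rw [mul_right_comm])
  obtain ⟨l, hl0, h1, h2, -⟩ := exists_approxUnit A
  constructor
  · refine hN.isClosed.mem_of_tendsto ((hl.tendsto n).comp (h1 n)) (Filter.Eventually.of_forall
      fun e => ?_)
    change ρ.lact α (e * n) ∈ N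
    rw [ρ.lact_mul]
    exact hN.mul_mem_left _ _ hn
  · refine hN.isClosed.mem_of_tendsto ((hr.tendsto n).comp (h2 n)) (Filter.Eventually.of_forall
      fun e => ?_)
    change ρ.ract α (n * e) ∈ N
    rw [ρ.ract_mul]
    exact hN.mul_mem_right _ hn _

/-- The action of `𝔄` on a closed two-sided ideal `N` of `A`, inherited from `A`. -/
abbrev CompatibleAction.onIdeal (ρ : CompatibleAction 𝔄 A) (N : Submodule ℂ A) [IsClosedIdeal N] :
    CompatibleAction 𝔄 (idealSubalgebra N) :=
  ρ.restrict (idealSubalgebra N) (ρ.invariant_ideal N)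

end Action

section ModuleTensorProduct

variable {𝔄 : Type w} {A : Type u} {B : Type v} [NonUnitalCStarAlgebra 𝔄]
  [NonUnitalCStarAlgebra A] [NonUnitalCStarAlgebra B]
  (ρA : CompatibleAction 𝔄 A) (ρB : CompatibleAction 𝔄 B)

/-- The two-sided ideal `I_{A,B}` of `A ⊙ B` generated by all `a·α ⊗ b - a ⊗ α·b`. -/
def moduleIdeal : Submodule ℂ (A ⊗[ℂ] B) :=
  sInf {J | (∀ α a b, ρA.ract α a ⊗ₜ[ℂ] b - a ⊗ₜ[ℂ] ρB.lact α b ∈ J) ∧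
    ∀ x, ∀ y ∈ J, x * y ∈ J ∧ y * x ∈ J}

lemma gen_mem_moduleIdeal (α : 𝔄) (a : A) (b : B) :
    ρA.ract α a ⊗ₜ[ℂ] b - a ⊗ₜ[ℂ] ρB.lact α b ∈ moduleIdeal ρA ρB :=
  Submodule.mem_sInf.mpr fun _ hJ => hJ.1 α a b

lemma mul_mem_moduleIdeal (x : A ⊗[ℂ] B) {y : A ⊗[ℂ] B} (hy : y ∈ moduleIdeal ρA ρB) :
    x * y ∈ moduleIdeal ρA ρB ∧ y * x ∈ moduleIdeal ρA ρB :=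
  ⟨Submodule.mem_sInf.mpr fun J hJ => (hJ.2 x y (Submodule.mem_sInf.mp hy J hJ)).1,
    Submodule.mem_sInf.mpr fun J hJ => (hJ.2 x y (Submodule.mem_sInf.mp hy J hJ)).2⟩

/-- The closure of `I_{A,B}` in `A ⊗_max B`. -/
def maxModuleIdeal : Submodule ℂ (MaxTensor A B) :=
  ((moduleIdeal ρA ρB).map MaxTensor.of).topologicalClosure

instance : IsClosedIdeal (maxModuleIdeal ρA ρB) where
  isClosed := Submodule.isClosed_topologicalClosure _
  mul_mem_left c x hx := by
    have hc : IsClosed {p : MaxTensor A B | ∀ y ∈ (moduleIdeal ρA ρB).map MaxTensor.of,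
        p * y ∈ maxModuleIdeal ρA ρB} := by
      simp only [Set.ofPred_forall]
      exact isClosed_iInter fun y => isClosed_iInter fun _ =>
        (Submodule.isClosed_topologicalClosure _).preimage (continuous_id.mul continuous_const)
    have h : ∀ p : MaxTensor A B, ∀ y ∈ (moduleIdeal ρA ρB).map MaxTensor.of,
        p * y ∈ maxModuleIdeal ρA ρB := fun p =>
      MaxTensor.denseRange_of.induction_on p hc fun t => by
        rintro _ ⟨y, hy, rfl⟩
        rw [← MaxTensor.of_mul]
        exact Submodule.le_topologicalClosure _ ⟨_, (mul_mem_moduleIdeal ρA ρB t hy).1, rfl⟩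
    exact closure_minimal (h c) ((Submodule.isClosed_topologicalClosure _).preimage
      (continuous_const.mul continuous_id)) hx
  mul_mem_right x hx c := by
    have hc : IsClosed {p : MaxTensor A B | ∀ y ∈ (moduleIdeal ρA ρB).map MaxTensor.of,
        y * p ∈ maxModuleIdeal ρA ρB} := by
      simp only [Set.ofPred_forall]
      exact isClosed_iInter fun y => isClosed_iInter fun _ =>
        (Submodule.isClosed_topologicalClosure _).preimage (continuous_const.mul continuous_id)
    have h : ∀ p : MaxTensor A B, ∀ y ∈ (moduleIdeal ρA ρB).map MaxTensor.of,
        y * p ∈ maxModuleIdeal ρA ρB := fun p =>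
      MaxTensor.denseRange_of.induction_on p hc fun t => by
        rintro _ ⟨y, hy, rfl⟩
        rw [← MaxTensor.of_mul]
        exact Submodule.le_topologicalClosure _ ⟨_, (mul_mem_moduleIdeal ρA ρB t hy).2, rfl⟩
    exact closure_minimal (h c) ((Submodule.isClosed_topologicalClosure _).preimage
      (continuous_id.mul continuous_const)) hx

/-- The `𝔄`-module maximal tensor product `A ⊗_{𝔄,max} B`, realised as the quotient of
`A ⊗_max B` by the closure of `I_{A,B}`. By `norm_mk`, `denseRange_mk` and `mk_eq_zero` below it
is the completion of `A ⊙_𝔄 B = (A ⊙ B) / I_{A,B}` in the quotient of the maximal norm. -/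
def ModuleMaxTensor : Type (max u v) := IdealQuotient (maxModuleIdeal ρA ρB)

instance : NonUnitalCStarAlgebra (ModuleMaxTensor ρA ρB) :=
  inferInstanceAs (NonUnitalCStarAlgebra (IdealQuotient (maxModuleIdeal ρA ρB)))

namespace ModuleMaxTensor

/-- The canonical map `A ⊙ B → A ⊗_{𝔄,max} B`, `x ↦ x + I_{A,B}`. -/
def mk : A ⊗[ℂ] B →ₗ[ℂ] ModuleMaxTensor ρA ρB :=
  (IdealQuotient.mk (maxModuleIdeal ρA ρB)).comp MaxTensor.of

lemma mk_mul (x y : A ⊗[ℂ] B) : mk ρA ρB (x * y) = mk ρA ρB x * mk ρA ρB y := by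
  change IdealQuotient.mk _ (MaxTensor.of (x * y)) = _
  rw [MaxTensor.of_mul]
  rfl

lemma mk_star (x : A ⊗[ℂ] B) : mk ρA ρB (star x) = star (mk ρA ρB x) := by
  change IdealQuotient.mk _ (MaxTensor.of (star x)) = _
  rw [MaxTensor.of_star]
  rfl

lemma mk_eq_zero {x : A ⊗[ℂ] B} (hx : x ∈ moduleIdeal ρA ρB) : mk ρA ρB x = 0 :=
  (IdealQuotient.mk_eq_zero _).mpr (Submodule.le_topologicalClosure _ ⟨x, hx, rfl⟩)

lemma denseRange_mk : DenseRange (mk ρA ρB) :=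
  (IdealQuotient.mk_surjective (maxModuleIdeal ρA ρB)).denseRange.comp MaxTensor.denseRange_of
    (AddMonoidHomClass.continuous_of_bound (IdealQuotient.mk (maxModuleIdeal ρA ρB)) 1
      fun x => by simpa using IdealQuotient.norm_mk_le _ x)

/-- The norm of `A ⊗_{𝔄,max} B` is the quotient norm on `A ⊙_𝔄 B` of the maximal norm. -/
lemma norm_mk (x : A ⊗[ℂ] B) : ‖mk ρA ρB x‖ = ⨅ i : moduleIdeal ρA ρB, maxNorm (x + (i : A ⊗[ℂ] B)) := by
  have hbdd : BddBelow (Set.range fun i : moduleIdeal ρA ρB => maxNorm (x + (i : A ⊗[ℂ] B))) :=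
    ⟨0, by rintro _ ⟨i, rfl⟩; exact maxNorm_nonneg _⟩
  apply le_antisymm
  · refine le_ciInf fun i => ?_
    have h : mk ρA ρB x = mk ρA ρB (x + i) := by
      rw [map_add, mk_eq_zero ρA ρB i.2, add_zero]
    rw [h, ← MaxTensor.norm_of]
    exact IdealQuotient.norm_mk_le _ _
  · refine le_of_forall_pos_le_add fun ε hε => ?_
    obtain ⟨m, hm, hlt⟩ := IdealQuotient.norm_mk_lt (maxModuleIdeal ρA ρB) (mk ρA ρB x)
      (half_pos hε)
    have hlt' : ‖m‖ < ‖mk ρA ρB x‖ + ε / 2 := hlt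
    have hmem : m - MaxTensor.of x ∈ maxModuleIdeal ρA ρB := IdealQuotient.mk_eq_mk.mp hm
    obtain ⟨_, ⟨i, hi, rfl⟩, hd⟩ := Metric.mem_closure_iff.mp hmem (ε / 2) (half_pos hε)
    refine (ciInf_le hbdd ⟨i, hi⟩).trans ?_
    rw [← MaxTensor.norm_of, map_add]
    rw [dist_eq_norm, ← norm_neg] at hd
    have h : MaxTensor.of x + MaxTensor.of i =
        m + -(m - MaxTensor.of x - MaxTensor.of i) := by abel
    change ‖MaxTensor.of x + MaxTensor.of i‖ ≤ _
    rw [h]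
    exact (norm_add_le _ _).trans (by linarith)

end ModuleMaxTensor

/-- The inclusion `D ⊆ A` of an `𝔄`-stable `C*`-subalgebra is `𝔄`-max-injective: for every `C`
the maximal norm on `D ⊙_𝔄 C` is the norm inherited from `A ⊗_{𝔄,max} C`. -/
def IsModuleMaxInjective (D : NonUnitalStarSubalgebra ℂ A) [IsClosed (D : Set A)]
    (hD : ρA.Invariant D) : Prop :=
  ∀ (C : Type v) [NonUnitalCStarAlgebra C] (ρC : CompatibleAction 𝔄 C) (x : D ⊗[ℂ] C),
    ‖ModuleMaxTensor.mk (ρA.restrict D hD) ρC x‖ =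
      ‖ModuleMaxTensor.mk ρA ρC (LinearMap.rTensor C D.toNonUnitalSubalgebra.toSubmodule.subtype x)‖

end ModuleTensorProduct

end ModuleTensor

end

/-! Two facts combine. First, the maximal norm of `A ⊙ B` restricts to that of `N ⊙ B`. A
representation `π` of `N`, even a degenerate one, extends to `A` by `a ↦ lim π(a e)` strongly, with
`e` running through an approximate unit of `N`. The limit exists on `π(N)H`, and every `π(a e)`
vanishes on its orthogonal complement. Operators commuting with `π(N)` commute with these limits, so
a commuting pair for `(N, B)` extends to one for `(A, B)` (`repExtend`, `repExtend_commute`,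
`maxNorm_idealTensorIncl`).

Second, the larger ideal `I_{A,B}` contributes nothing new to the quotient norm on `N ⊙ B`. It need
not meet `N ⊙ B` exactly in `I_{N,B}`, but for `i ∈ I_{A,B}` and `p ∈ N ⊙ B` the product `p (p i) p`
is the image of an element of `I_{N,B}` (`mul_moduleIdeal_mul_mem`). With `p` a contractive
approximate unit from `N ⊙ B`, the class of `p p x p` over `N` therefore has norm at most `‖p p (x +
i) p‖_max ≤ ‖x + i‖_max`. The limit in `p` and the infimum over `i` give the nontrivial inequality
of `norm_mk_idealTensorIncl`; the isometry then follows by density. -/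

noncomputable section

namespace ModuleTensor

/-! ### Extending representations from a closed ideal to the whole algebra. -/

section Extension

open Filter Topology

variable {H : Type*} [NormedAddCommGroup H] [InnerProductSpace ℂ H] [CompleteSpace H]

/-- The subspace of vectors along which a family of operators converges pointwise. -/
def convergenceSubspace {ι : Type*} (l : Filter ι) (T : ι → H →L[ℂ] H) : Submodule ℂ H where
  carrier := {ξ | ∃ y, Tendsto (fun i => T i ξ) l (𝓝 y)}
  add_mem' := by
    rintro a b ⟨y, hy⟩ ⟨z, hz⟩
    exact ⟨y + z, by simpa using hy.add hz⟩
  zero_mem' := ⟨0, by simpa using tendsto_const_nhds⟩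
  smul_mem' := by
    rintro c a ⟨y, hy⟩
    exact ⟨c • y, by simpa using hy.const_smul c⟩

/-- The eventual uniform bound transfers the Cauchy property from nearby vectors, and `H` is
complete. -/
lemma isClosed_convergenceSubspace {ι : Type*} (l : Filter ι) [l.NeBot] (T : ι → H →L[ℂ] H)
    {C : ℝ} (hC : ∀ᶠ i in l, ‖T i‖ ≤ C) : IsClosed (convergenceSubspace l T : Set H) := by
  refine isClosed_of_closure_subset fun ξ hξ => ?_
  have hC0 : 0 ≤ C := by
    obtain ⟨i, hi⟩ := hC.exists
    exact (norm_nonneg _).trans hi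
  refine cauchy_map_iff_exists_tendsto.mp (Metric.cauchy_iff.mpr ⟨inferInstance, fun ε hε => ?_⟩)
  -- Moving `ξ` to `ζ` then costs at most `ε / 3`; `C + 1` keeps the denominator positive when `C =
  -- 0`. With the `ε / 6` below this stays within a ball of radius `ε / 2`, so two points of it are
  -- less than `ε` apart.
  have hδ : 0 < ε / (3 * (C + 1)) := by positivity
  obtain ⟨ζ, ⟨y, hy⟩, hd⟩ := Metric.mem_closure_iff.mp hξ _ hδ
  have hs : ∀ᶠ i in l, dist (T i ξ) y < ε / 2 := by
    filter_upwards [hC, Metric.tendsto_nhds.mp hy (ε / 6) (by positivity)] with i hi hi'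
    have h1 : dist (T i ξ) (T i ζ) ≤ C * dist ξ ζ := by
      rw [dist_eq_norm, dist_eq_norm, ← map_sub]
      exact (T i).le_of_opNorm_le hi _
    have h2 : C * dist ξ ζ ≤ ε / 3 := by
      rw [lt_div_iff₀ (by positivity)] at hd
      nlinarith [dist_nonneg (x := ξ) (y := ζ)]
    linarith [dist_triangle (T i ξ) (T i ζ) y]
  refine ⟨Metric.ball y (ε / 2), hs, fun a ha b hb => ?_⟩
  have := dist_triangle_right a b y
  rw [Metric.mem_ball] at ha hb
  linarith

/-- Split `ξ` along the closed span of `S` and its orthogonal complement: linearity and closedness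
give convergence on the former, and the operators vanish on the latter. This replaces a
nondegeneracy assumption on the representation. -/
lemma exists_tendsto_of_orthogonal {ι : Type*} (l : Filter ι) [l.NeBot] (T : ι → H →L[ℂ] H)
    {C : ℝ} (hC : ∀ᶠ i in l, ‖T i‖ ≤ C) (S : Set H)
    (hS : ∀ s ∈ S, ∃ y, Tendsto (fun i => T i s) l (𝓝 y))
    (hS' : ∀ ξ, (∀ s ∈ S, inner ℂ s ξ = 0) → ∀ i, T i ξ = 0) (ξ : H) :
    ∃ y, Tendsto (fun i => T i ξ) l (𝓝 y) := by
  have hK : (Submodule.span ℂ S).topologicalClosure ≤ convergenceSubspace l T :=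
    Submodule.topologicalClosure_minimal _ (Submodule.span_le.mpr hS)
      (isClosed_convergenceSubspace l T hC)
  have : CompleteSpace (Submodule.span ℂ S).topologicalClosure :=
    (Submodule.isClosed_topologicalClosure _).completeSpace_coe
  obtain ⟨y, hy, z, hz, rfl⟩ :=
    (Submodule.span ℂ S).topologicalClosure.exists_add_mem_mem_orthogonal ξ
  refine (convergenceSubspace l T).add_mem (hK hy) ⟨0, ?_⟩
  have h0 : ∀ i, T i z = 0 := hS' z fun s hs => hz s
    (Submodule.le_topologicalClosure _ (Submodule.subset_span hs))
  simp [h0]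

variable {A : Type u} [NonUnitalCStarAlgebra A] (N : Submodule ℂ A) [hN : IsClosedIdeal N]

/-- The product `a n` of an element of the algebra and one of the ideal, in the ideal. -/
def idealMulLeft (a : A) : idealSubalgebra N →ₗ[ℂ] idealSubalgebra N where
  toFun n := ⟨a * n, hN.mul_mem_left a n n.2⟩
  map_add' m n := Subtype.ext (mul_add a (m : A) n)
  map_smul' c n := Subtype.ext (mul_smul_comm c a (n : A))

/-- The product `n a` of an element of the ideal and one of the algebra, in the ideal. -/
def idealMulRight (a : A) : idealSubalgebra N →ₗ[ℂ] idealSubalgebra N where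
  toFun n := ⟨n * a, hN.mul_mem_right n n.2 a⟩
  map_add' m n := Subtype.ext (add_mul (m : A) n a)
  map_smul' c n := Subtype.ext (smul_mul_assoc c (n : A) a)

@[simp] lemma coe_idealMulLeft (a : A) (n : idealSubalgebra N) :
    (idealMulLeft N a n : A) = a * n := rfl

@[simp] lemma coe_idealMulRight (a : A) (n : idealSubalgebra N) :
    (idealMulRight N a n : A) = n * a := rfl

lemma continuous_idealMulLeft (a : A) : Continuous (idealMulLeft N a) :=
  Continuous.subtype_mk (continuous_const.mul continuous_subtype_val) _

lemma norm_idealMulLeft_le (a : A) (n : idealSubalgebra N) :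
    ‖idealMulLeft N a n‖ ≤ ‖a‖ * ‖n‖ := norm_mul_le a (n : A)

variable {N} (π : idealSubalgebra N →⋆ₙₐ[ℂ] (H →L[ℂ] H))

lemma continuous_starHom_apply {D : Type*} [NonUnitalCStarAlgebra D] (π : D →⋆ₙₐ[ℂ] (H →L[ℂ] H))
    (ξ : H) : Continuous fun n => π n ξ :=
  (ContinuousLinearMap.apply ℂ H ξ).continuous.comp
    (AddMonoidHomClass.continuous_of_bound π 1 fun n => by
      simpa using NonUnitalStarAlgHom.norm_apply_le π n)

lemma inner_starHom_apply {D : Type*} [NonUnitalCStarAlgebra D] (π : D →⋆ₙₐ[ℂ] (H →L[ℂ] H))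
    (n : D) (ξ η : H) : inner ℂ (π (star n) ξ) η = inner ℂ ξ (π n η) := by
  rw [map_star, ContinuousLinearMap.star_eq_adjoint, ContinuousLinearMap.adjoint_inner_left]

/-- An approximate unit of the ideal, as a filter. -/
def idealUnit (N : Submodule ℂ A) [IsClosedIdeal N] : Filter (idealSubalgebra N) :=
  (exists_approxUnit (idealSubalgebra N)).choose

instance : (idealUnit N).NeBot := (exists_approxUnit (idealSubalgebra N)).choose_spec.1

lemma idealUnit_mul (n : idealSubalgebra N) : Tendsto (fun e => e * n) (idealUnit N) (𝓝 n) :=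
  (exists_approxUnit (idealSubalgebra N)).choose_spec.2.1 n

lemma mul_idealUnit (n : idealSubalgebra N) : Tendsto (fun e => n * e) (idealUnit N) (𝓝 n) :=
  (exists_approxUnit (idealSubalgebra N)).choose_spec.2.2.1 n

lemma idealUnit_norm : ∀ᶠ e in idealUnit N, ‖e‖ ≤ 1 :=
  (exists_approxUnit (idealSubalgebra N)).choose_spec.2.2.2.mono fun _ h => h.2

lemma idealUnit_star : ∀ᶠ e in idealUnit N, star e = e :=
  (exists_approxUnit (idealSubalgebra N)).choose_spec.2.2.2.mono fun e h => by
    obtain ⟨⟨s, rfl⟩, -⟩ := h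
    simp

/-- Here `S = π(N)H`, where `π(M e) π(n) η = π(M (e n)) η` tends to `π(M n) η` because `M` is a
right module map. It serves both for left multiplication by `a` and for `M = id`, whose limit
projects onto the closed span of `π(N)H`. -/
lemma exists_tendsto_rep (M : idealSubalgebra N →ₗ[ℂ] idealSubalgebra N) (hMc : Continuous M)
    {C : ℝ} (hC0 : 0 ≤ C) (hMb : ∀ n, ‖M n‖ ≤ C * ‖n‖) (hM : ∀ m n, M (m * n) = M m * n) (ξ : H) :
    ∃ y, Tendsto (fun e => π (M e) ξ) (idealUnit N) (𝓝 y) := by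
  refine exists_tendsto_of_orthogonal (idealUnit N) (fun e => π (M e)) (C := C) ?_
    {x | ∃ n η, x = π n η} ?_ ?_ ξ
  · filter_upwards [idealUnit_norm] with e he
    calc ‖π (M e)‖ ≤ ‖M e‖ := NonUnitalStarAlgHom.norm_apply_le π _
      _ ≤ C * ‖e‖ := hMb e
      _ ≤ C * 1 := mul_le_mul_of_nonneg_left he hC0
      _ = C := mul_one C
  · rintro _ ⟨n, η, rfl⟩
    refine ⟨π (M n) η, ?_⟩
    have h : ∀ e, π (M e) (π n η) = π (M (e * n)) η := fun e => by
      rw [hM, map_mul]; rfl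
    simp only [h]
    exact (((continuous_starHom_apply π η).comp hMc).tendsto n).comp (idealUnit_mul n)
  · intro ζ hζ e
    -- The squared norm of `π(M e) ζ` equals the inner product of `π((M e)*) π(M e) ζ` with `ζ`, and
    -- the former vector lies in `π(N)H`.
    rw [← inner_self_eq_zero (𝕜 := ℂ), ← inner_starHom_apply]
    exact hζ _ ⟨_, _, rfl⟩

lemma exists_tendsto_rep_left (a : A) (ξ : H) :
    ∃ y, Tendsto (fun e => π (idealMulLeft N a e) ξ) (idealUnit N) (𝓝 y) :=
  exists_tendsto_rep π (idealMulLeft N a) (continuous_idealMulLeft N a) (norm_nonneg a)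
    (norm_idealMulLeft_le N a) (fun m n => Subtype.ext (mul_assoc a (m : A) n).symm) ξ

/-- The canonical extension `π̃(a) ξ = lim π(a e) ξ` of a representation of an ideal, as an
operator for each `a`. -/
def repExtendOp (a : A) : H →L[ℂ] H :=
  LinearMap.mkContinuous
    { toFun := fun ξ => (exists_tendsto_rep_left π a ξ).choose
      map_add' := fun ξ η => tendsto_nhds_unique (exists_tendsto_rep_left π a (ξ + η)).choose_spec
        (by simpa using (exists_tendsto_rep_left π a ξ).choose_spec.add
              (exists_tendsto_rep_left π a η).choose_spec)
      map_smul' := fun c ξ => tendsto_nhds_unique (exists_tendsto_rep_left π a (c • ξ)).choose_spec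
        (by simpa using (exists_tendsto_rep_left π a ξ).choose_spec.const_smul c) }
    ‖a‖ fun ξ => by
      refine le_of_tendsto (exists_tendsto_rep_left π a ξ).choose_spec.norm ?_
      filter_upwards [idealUnit_norm] with e he
      refine ((π (idealMulLeft N a e)).le_opNorm ξ).trans
        (mul_le_mul_of_nonneg_right ?_ (norm_nonneg ξ))
      calc ‖π (idealMulLeft N a e)‖ ≤ ‖idealMulLeft N a e‖ := NonUnitalStarAlgHom.norm_apply_le π _
        _ ≤ ‖a‖ * ‖e‖ := norm_idealMulLeft_le N a e
        _ ≤ ‖a‖ * 1 := mul_le_mul_of_nonneg_left he (norm_nonneg a)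
        _ = ‖a‖ := mul_one _

lemma tendsto_repExtendOp (a : A) (ξ : H) :
    Tendsto (fun e => π (idealMulLeft N a e) ξ) (idealUnit N) (𝓝 (repExtendOp π a ξ)) :=
  (exists_tendsto_rep_left π a ξ).choose_spec

lemma repExtendOp_coe (n : idealSubalgebra N) : repExtendOp π (n : A) = π n := by
  ext ξ
  exact tendsto_nhds_unique (tendsto_repExtendOp π n ξ)
    (((continuous_starHom_apply π ξ).tendsto n).comp (mul_idealUnit n))

lemma repExtendOp_rep (a : A) (n : idealSubalgebra N) (ξ : H) :
    repExtendOp π a (π n ξ) = π (idealMulLeft N a n) ξ := by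
  refine tendsto_nhds_unique (tendsto_repExtendOp π a (π n ξ)) ?_
  have h : ∀ e, π (idealMulLeft N a e) (π n ξ) = π (idealMulLeft N a (e * n)) ξ := fun e => by
    have h' : idealMulLeft N a (e * n) = idealMulLeft N a e * n :=
      Subtype.ext (mul_assoc a (e : A) n).symm
    rw [h', map_mul]; rfl
  simp only [h]
  exact (((continuous_starHom_apply π ξ).comp (continuous_idealMulLeft N a)).tendsto n).comp
    (idealUnit_mul n)

lemma rep_repExtendOp (a : A) (n : idealSubalgebra N) (ξ : H) :
    π n (repExtendOp π a ξ) = π (idealMulRight N a n) ξ := by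
  refine tendsto_nhds_unique (((π n).continuous.tendsto _).comp (tendsto_repExtendOp π a ξ)) ?_
  have h : ∀ e, (π n ∘ fun e => π (idealMulLeft N a e) ξ) e = π (idealMulRight N a n * e) ξ :=
    fun e => by
      have h' : idealMulRight N a n * e = n * idealMulLeft N a e :=
        Subtype.ext (mul_assoc (n : A) a e)
      rw [h', map_mul]; rfl
  rw [funext h]
  exact ((continuous_starHom_apply π ξ).tendsto _).comp (mul_idealUnit _)

/-- Since `(a b) e = a (b e)` with `b e` in `N`, `repExtendOp_rep` takes the operator of `a` out of
the limit. -/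
lemma repExtendOp_mul (a b : A) : repExtendOp π (a * b) = repExtendOp π a * repExtendOp π b := by
  ext ξ
  refine tendsto_nhds_unique (tendsto_repExtendOp π (a * b) ξ) ?_
  have h : ∀ e, π (idealMulLeft N (a * b) e) ξ = repExtendOp π a (π (idealMulLeft N b e) ξ) :=
    fun e => by
      rw [repExtendOp_rep]
      congr 2
      exact Subtype.ext (mul_assoc a b (e : A))
  simp only [h]
  exact ((repExtendOp π a).continuous.tendsto _).comp (tendsto_repExtendOp π b ξ)

/-- As `π` may be degenerate, `π(e) ξ` need not tend to `ξ`. Its limit `ζ` is used instead: the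
adjoint relation holds with `ζ` in place of `ξ`, and `π(n) ζ = π(n) ξ` for all `n` in `N` allows the
return to `ξ`. -/
lemma inner_repExtendOp_star (a : A) (ξ η : H) :
    inner ℂ (repExtendOp π (star a) ξ) η = inner ℂ ξ (repExtendOp π a η) := by
  obtain ⟨ζ, hζ⟩ := exists_tendsto_rep π LinearMap.id continuous_id zero_le_one
    (fun n => (one_mul ‖n‖).ge) (fun _ _ => rfl) ξ
  simp only [LinearMap.id_apply] at hζ
  have hstar : ∀ n : idealSubalgebra N,
      star (idealMulRight N a n) = idealMulLeft N (star a) (star n) := fun n =>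
    Subtype.ext (star_mul (n : A) a)
  have hπζ : ∀ n, π n ζ = π n ξ := fun n => by
    refine tendsto_nhds_unique (((π n).continuous.tendsto _).comp hζ) ?_
    have h : ∀ e, (π n ∘ fun e => π e ξ) e = π (n * e) ξ := fun e => by rw [map_mul]; rfl
    rw [funext h]
    exact ((continuous_starHom_apply π ξ).tendsto _).comp (mul_idealUnit _)
  -- Both sides are limits of one net, because `(e a)* = a* e` for self-adjoint `e`.
  have h1 : inner ℂ (repExtendOp π (star a) ξ) η = inner ℂ ζ (repExtendOp π a η) := by
    refine tendsto_nhds_unique ((tendsto_repExtendOp π (star a) ξ).inner tendsto_const_nhds)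
      (Tendsto.congr' ?_ (hζ.inner tendsto_const_nhds))
    filter_upwards [idealUnit_star] with e he
    calc inner ℂ (π e ξ) (repExtendOp π a η)
        = inner ℂ (π (star e) ξ) (repExtendOp π a η) := by rw [he]
      _ = inner ℂ (π (star (idealMulRight N a e)) ξ) η := by
        rw [inner_starHom_apply, inner_starHom_apply, rep_repExtendOp]
      _ = inner ℂ (π (idealMulLeft N (star a) e) ξ) η := by rw [hstar, he]
  rw [h1]
  -- The vectors `π(a e) η` approximating the second argument lie in `π(N)H`, and pairing with such
  -- vectors does not distinguish `ζ` from `ξ`.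
  refine tendsto_nhds_unique (tendsto_const_nhds.inner (tendsto_repExtendOp π a η))
    (Tendsto.congr (fun e => ?_) (tendsto_const_nhds.inner (tendsto_repExtendOp π a η)))
  rw [← inner_starHom_apply, ← inner_starHom_apply, hπζ]

/-- The canonical extension of a representation of a closed ideal to the whole algebra. -/
def repExtend : A →⋆ₙₐ[ℂ] (H →L[ℂ] H) where
  toFun := repExtendOp π
  map_smul' c a := by
    ext ξ
    refine tendsto_nhds_unique (tendsto_repExtendOp π (c • a) ξ)
      (((tendsto_repExtendOp π a ξ).const_smul c).congr fun e => ?_)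
    have h : idealMulLeft N (c • a) e = c • idealMulLeft N a e :=
      Subtype.ext (smul_mul_assoc c a (e : A))
    rw [h, map_smul]; rfl
  map_zero' := (repExtendOp_coe π (0 : idealSubalgebra N)).trans (map_zero π)
  map_add' a b := by
    ext ξ
    refine tendsto_nhds_unique (tendsto_repExtendOp π (a + b) ξ)
      (((tendsto_repExtendOp π a ξ).add (tendsto_repExtendOp π b ξ)).congr fun e => ?_)
    have h : idealMulLeft N (a + b) e = idealMulLeft N a e + idealMulLeft N b e :=
      Subtype.ext (add_mul a b (e : A))
    rw [h, map_add]; rfl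
  map_mul' := repExtendOp_mul π
  map_star' a := by
    rw [ContinuousLinearMap.star_eq_adjoint, ContinuousLinearMap.eq_adjoint_iff]
    exact inner_repExtendOp_star π a

@[simp] lemma repExtend_coe (n : idealSubalgebra N) : repExtend π (n : A) = π n :=
  repExtendOp_coe π n

/-- A bounded operator that commutes with every `π(a e)` commutes with their strong limit. -/
lemma repExtend_commute (T : H →L[ℂ] H) (hT : ∀ n, π n * T = T * π n) (a : A) :
    repExtend π a * T = T * repExtend π a := by
  ext ξ
  refine tendsto_nhds_unique (tendsto_repExtendOp π a (T ξ))
    (((T.continuous.tendsto _).comp (tendsto_repExtendOp π a ξ)).congr fun e => ?_)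
  exact (DFunLike.congr_fun (hT (idealMulLeft N a e)) ξ).symm

end Extension

/-! ### The maximal norm on `N ⊙ B` as a restriction. -/

section IdealTensor

variable {A : Type u} {B : Type v} [NonUnitalCStarAlgebra A] [NonUnitalCStarAlgebra B]
  (N : Submodule ℂ A) [hN : IsClosedIdeal N]

variable (B) in
/-- The inclusion `N ⊙ B → A ⊙ B`. -/
def idealTensorIncl : idealSubalgebra N ⊗[ℂ] B →ₗ[ℂ] A ⊗[ℂ] B :=
  LinearMap.rTensor B (idealSubalgebra N).toNonUnitalSubalgebra.toSubmodule.subtype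

@[simp] lemma idealTensorIncl_tmul (n : idealSubalgebra N) (b : B) :
    idealTensorIncl B N (n ⊗ₜ b) = (n : A) ⊗ₜ b := rfl

lemma idealTensorIncl_mul (x y : idealSubalgebra N ⊗[ℂ] B) :
    idealTensorIncl B N (x * y) = idealTensorIncl B N x * idealTensorIncl B N y := by
  induction x with
  | zero => simp
  | add x₁ x₂ h₁ h₂ => rw [add_mul, map_add, h₁, h₂, map_add, add_mul]
  | tmul a b =>
    induction y with
    | zero => simp
    | add y₁ y₂ h₁ h₂ => rw [mul_add, map_add, h₁, h₂, map_add, mul_add]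
    | tmul c d => simp

lemma idealTensorIncl_star (x : idealSubalgebra N ⊗[ℂ] B) :
    idealTensorIncl B N (star x) = star (idealTensorIncl B N x) := by
  induction x with
  | zero => simp
  | add x₁ x₂ h₁ h₂ => rw [star_add, map_add, h₁, h₂, map_add, star_add]
  | tmul a b => simp

/-- Commuting pairs correspond in both directions: a pair for `(A, B)` restricts to `N`, and a pair
for `(N, B)` extends by `repExtend` on the same Hilbert space. Each operation preserves the
operators assigned to elements of `N ⊙ B`. -/
lemma maxNorm_idealTensorIncl (x : idealSubalgebra N ⊗[ℂ] B) :
    maxNorm (idealTensorIncl B N x) = maxNorm x := by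
  apply le_antisymm
  · refine maxNorm_le fun R => ?_
    let R' : CommutingRep (idealSubalgebra N) B :=
      { H := R.H
        repA := R.repA.comp (NonUnitalStarSubalgebraClass.subtype (idealSubalgebra N))
        repB := R.repB
        commute := fun a b => R.commute a b }
    have h : R.prod ∘ₗ idealTensorIncl B N = R'.prod := TensorProduct.ext' fun _ _ => rfl
    exact (congrArg norm (LinearMap.congr_fun h x)).le.trans (le_maxNorm R' x)
  · refine maxNorm_le fun R => ?_
    let R' : CommutingRep A B :=
      { H := R.H
        repA := repExtend R.repA
        repB := R.repB
        commute := fun a b => repExtend_commute R.repA _ (fun n => R.commute n b) a }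
    have h : R'.prod ∘ₗ idealTensorIncl B N = R.prod := TensorProduct.ext' fun n b => by
      simp [R']
    exact (congrArg norm (LinearMap.congr_fun h x)).ge.trans (le_maxNorm R' _)

end IdealTensor

/-! ### Comparing `I_{N,B}` with `I_{A,B}`. -/

section IdealModuleTensor

open Filter Topology

variable {𝔄 : Type w} {A : Type u} {B : Type v} [NonUnitalCStarAlgebra 𝔄]
  [NonUnitalCStarAlgebra A] [NonUnitalCStarAlgebra B]
  (ρA : CompatibleAction 𝔄 A) (ρB : CompatibleAction 𝔄 B)
  (N : Submodule ℂ A) [hN : IsClosedIdeal N]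

lemma idealTensorIncl_mul_mem (p : idealSubalgebra N ⊗[ℂ] B) (x : A ⊗[ℂ] B) :
    idealTensorIncl B N p * x ∈ LinearMap.range (idealTensorIncl B N) := by
  induction p with
  | zero => simp
  | add p₁ p₂ h₁ h₂ => rw [map_add, add_mul]; exact add_mem h₁ h₂
  | tmul n b =>
    induction x with
    | zero => simp
    | add x₁ x₂ h₁ h₂ => rw [mul_add]; exact add_mem h₁ h₂
    | tmul a c => exact ⟨idealMulRight N a n ⊗ₜ (b * c), by simp⟩

lemma mul_idealTensorIncl_mem (p : idealSubalgebra N ⊗[ℂ] B) (x : A ⊗[ℂ] B) :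
    x * idealTensorIncl B N p ∈ LinearMap.range (idealTensorIncl B N) := by
  induction p with
  | zero => simp
  | add p₁ p₂ h₁ h₂ => rw [map_add, mul_add]; exact add_mem h₁ h₂
  | tmul n b =>
    induction x with
    | zero => simp
    | add x₁ x₂ h₁ h₂ => rw [add_mul]; exact add_mem h₁ h₂
    | tmul a c => exact ⟨idealMulLeft N a n ⊗ₜ (c * b), by simp⟩

/-- Multiplied twice on the left by elements of `N ⊙ B`, a generator of `I_{A,B}` falls into
`I_{N,B}`. -/
lemma mul_mul_gen_mem (p p' : idealSubalgebra N ⊗[ℂ] B) (α : 𝔄) (a : A) (b : B) :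
    idealTensorIncl B N p *
        (idealTensorIncl B N p' * (ρA.ract α a ⊗ₜ[ℂ] b - a ⊗ₜ[ℂ] ρB.lact α b)) ∈
      (moduleIdeal (ρA.onIdeal N) ρB).map (idealTensorIncl B N) := by
  induction p with
  | zero => simp
  | add p₁ p₂ h₁ h₂ => rw [map_add, add_mul]; exact add_mem h₁ h₂
  | tmul m c =>
    induction p' with
    | zero => simp
    | add p₁ p₂ h₁ h₂ => rw [map_add, add_mul, mul_add]; exact add_mem h₁ h₂
    | tmul n d =>
      -- The factor `n` moves `a` into the ideal, since `n (a·α) = (n a)·α`. The element `d` cannot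
      -- be moved past `α` in `d (α·b)`, so it stays in a left multiplier; `m` supplies the
      -- component in `N` which that multiplier needs.
      refine ⟨_, (mul_mem_moduleIdeal _ _ (m ⊗ₜ (c * d))
        (gen_mem_moduleIdeal (ρA.onIdeal N) ρB α (idealMulRight N a n) b)).1, ?_⟩
      have h : ((ρA.onIdeal N).ract α (idealMulRight N a n) : A) = n * ρA.ract α a :=
        ρA.ract_mul α (n : A) a
      rw [idealTensorIncl_mul, map_sub, idealTensorIncl_tmul, idealTensorIncl_tmul,
        idealTensorIncl_tmul, h]
      simp only [mul_sub, idealTensorIncl_tmul, Algebra.TensorProduct.tmul_mul_tmul, coe_idealMulRight, mul_assoc]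

/-- The `i` satisfying this for all `p`, `p'`, `q` form a two-sided ideal `J` containing the
generators. Quantifying over the factors matters: an outer multiplier from `A ⊙ B` is absorbed by
`p'` on the left or by `q` on the right, and changes that factor within `N ⊙ B`. -/
lemma mul_moduleIdeal_mul_mem {i : A ⊗[ℂ] B} (hi : i ∈ moduleIdeal ρA ρB)
    (p p' q : idealSubalgebra N ⊗[ℂ] B) :
    idealTensorIncl B N p * (idealTensorIncl B N p' * i) * idealTensorIncl B N q ∈
      (moduleIdeal (ρA.onIdeal N) ρB).map (idealTensorIncl B N) := by
  let J : Submodule ℂ (A ⊗[ℂ] B) :=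
    { carrier := {i | ∀ p p' q : idealSubalgebra N ⊗[ℂ] B,
        idealTensorIncl B N p * (idealTensorIncl B N p' * i) * idealTensorIncl B N q ∈
          (moduleIdeal (ρA.onIdeal N) ρB).map (idealTensorIncl B N)}
      add_mem' := fun h₁ h₂ p p' q => by
        simp only [mul_add, add_mul]
        exact add_mem (h₁ p p' q) (h₂ p p' q)
      zero_mem' := fun p p' q => by simp
      smul_mem' := fun c x h p p' q => by
        simp only [mul_smul_comm, smul_mul_assoc]
        exact Submodule.smul_mem _ c (h p p' q) }
  refine Submodule.mem_sInf.mp hi J ⟨fun α a b p p' q => ?_, fun x y hy => ⟨fun p p' q => ?_,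
    fun p p' q => ?_⟩⟩ p p' q
  · obtain ⟨k, hk, h⟩ := mul_mul_gen_mem ρA ρB N p p' α a b
    exact ⟨k * q, (mul_mem_moduleIdeal _ _ q hk).2, by rw [idealTensorIncl_mul, h]⟩
  · obtain ⟨r, hr⟩ := idealTensorIncl_mul_mem N p' x
    rw [← mul_assoc (idealTensorIncl B N p'), ← hr]
    exact hy p r q
  · obtain ⟨r, hr⟩ := mul_idealTensorIncl_mem N q x
    have h := hy p p' r
    rw [hr] at h
    simpa only [mul_assoc] using h

/-- The preimage of `I_{A,B}` in `N ⊙ B` is a two-sided ideal containing the generators of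
`I_{N,B}`. -/
lemma idealTensorIncl_mem_moduleIdeal {i : idealSubalgebra N ⊗[ℂ] B}
    (hi : i ∈ moduleIdeal (ρA.onIdeal N) ρB) : idealTensorIncl B N i ∈ moduleIdeal ρA ρB := by
  refine Submodule.mem_sInf.mp hi ((moduleIdeal ρA ρB).comap (idealTensorIncl B N))
    ⟨fun α a b => ?_, fun x y hy => ?_⟩
  · exact gen_mem_moduleIdeal ρA ρB α (a : A) b
  · simp only [Submodule.mem_comap, idealTensorIncl_mul] at hy ⊢
    exact mul_mem_moduleIdeal ρA ρB _ hy

/-! ### Approximate units and the equality of the quotient norms. -/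

lemma ModuleMaxTensor.norm_mk_le (x : A ⊗[ℂ] B) : ‖mk ρA ρB x‖ ≤ maxNorm x :=
  (IdealQuotient.norm_mk_le _ _).trans_eq (MaxTensor.norm_of x)

lemma maxNorm_tmul_le (a : A) (b : B) : maxNorm (a ⊗ₜ[ℂ] b) ≤ ‖a‖ * ‖b‖ :=
  maxNorm_le fun R => by
    rw [R.prod_tmul]
    exact (norm_mul_le _ _).trans (mul_le_mul (NonUnitalStarAlgHom.norm_apply_le _ _)
      (NonUnitalStarAlgHom.norm_apply_le _ _) (norm_nonneg _) (norm_nonneg _))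

lemma ModuleMaxTensor.continuous_mk_tmul :
    Continuous fun p : A × B => mk ρA ρB (p.1 ⊗ₜ p.2) :=
  (((TensorProduct.mk ℂ A B).compr₂ (mk ρA ρB)).mkContinuous₂ 1 fun a b => by
    simpa using (norm_mk_le ρA ρB _).trans (maxNorm_tmul_le a b)).continuous₂

/-- `A ⊙ B` has a net of contractions that is an approximate unit for `A ⊗_{𝔄,max} B`. -/
lemma exists_tensor_approxUnit (A : Type u) (B : Type v) [NonUnitalCStarAlgebra A]
    [NonUnitalCStarAlgebra B] : ∃ l : Filter (A ⊗[ℂ] B), l.NeBot ∧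
      (∀ᶠ p in l, maxNorm p ≤ 1) ∧
      ∀ (ρA : CompatibleAction 𝔄 A) (ρB : CompatibleAction 𝔄 B) (x : A ⊗[ℂ] B),
        Tendsto (fun p => ModuleMaxTensor.mk ρA ρB (p * x)) l (𝓝 (ModuleMaxTensor.mk ρA ρB x)) ∧
        Tendsto (fun p => ModuleMaxTensor.mk ρA ρB (x * p)) l (𝓝 (ModuleMaxTensor.mk ρA ρB x)) := by
  obtain ⟨l, hl, h1, h2, h3⟩ := exists_approxUnit A
  obtain ⟨m, hm, k1, k2, k3⟩ := exists_approxUnit B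
  -- Elementary tensors `e ⊗ f` of the two approximate units, indexed by the product filter; the
  -- choice does not depend on the actions.
  refine ⟨(l ×ˢ m).map fun p => p.1 ⊗ₜ p.2, inferInstance, ?_, fun ρA ρB x => ?_⟩
  · rw [eventually_map]
    filter_upwards [h3.prod_mk k3] with p hp
    exact (maxNorm_tmul_le p.1 p.2).trans (mul_le_one₀ hp.1.2 (norm_nonneg _) hp.2.2)
  · simp only [tendsto_map'_iff]
    induction x with
    | zero => simp [Function.comp_def]
    | add x₁ x₂ g₁ g₂ =>
      simp only [Function.comp_def, mul_add, add_mul, map_add] at g₁ g₂ ⊢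
      exact ⟨g₁.1.add g₂.1, g₁.2.add g₂.2⟩
    | tmul a b =>
      simp only [Function.comp_def, Algebra.TensorProduct.tmul_mul_tmul]
      have hc := (ModuleMaxTensor.continuous_mk_tmul ρA ρB).tendsto (a, b)
      have hl : Tendsto (fun p : A × B => (p.1 * a, p.2 * b)) (l ×ˢ m) (𝓝 (a, b)) :=
        ((h1 a).comp tendsto_fst).prodMk_nhds ((k1 b).comp tendsto_snd)
      have hr : Tendsto (fun p : A × B => (a * p.1, b * p.2)) (l ×ˢ m) (𝓝 (a, b)) :=
        ((h2 a).comp tendsto_fst).prodMk_nhds ((k2 b).comp tendsto_snd)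
      have hl' := hc.comp hl
      have hr' := hc.comp hr
      rw [Function.comp_def] at hl' hr'
      exact ⟨hl', hr'⟩

/-- Write `p y = p (y - x) + p x`. This permits repeated multiplication by the same approximate
unit. -/
lemma tendsto_mul_of_norm_le_one {ι R : Type*} [NonUnitalSeminormedRing R] {l : Filter ι}
    {p y : ι → R} {x : R} (hp : ∀ᶠ i in l, ‖p i‖ ≤ 1) (hx : Tendsto (fun i => p i * x) l (𝓝 x))
    (hy : Tendsto y l (𝓝 x)) : Tendsto (fun i => p i * y i) l (𝓝 x) := by
  have h : Tendsto (fun i => p i * (y i - x)) l (𝓝 0) := by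
    refine squeeze_zero_norm' ?_ (tendsto_iff_norm_sub_tendsto_zero.mp hy)
    filter_upwards [hp] with i hi
    exact (norm_mul_le _ _).trans (mul_le_of_le_one_left (norm_nonneg _) hi)
  simpa [mul_sub] using h.add hx

lemma ModuleMaxTensor.norm_mk_idealTensorIncl (x : idealSubalgebra N ⊗[ℂ] B) :
    ‖mk ρA ρB (idealTensorIncl B N x)‖ = ‖mk (ρA.onIdeal N) ρB x‖ := by
  apply le_antisymm
  · rw [norm_mk (ρA.onIdeal N)]
    refine le_ciInf fun i => ?_
    have h := mk_eq_zero ρA ρB (idealTensorIncl_mem_moduleIdeal ρA ρB N i.2)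
    have h' : mk ρA ρB (idealTensorIncl B N x) = mk ρA ρB (idealTensorIncl B N (x + i)) := by
      rw [map_add, map_add, h, add_zero]
    rw [h', ← maxNorm_idealTensorIncl]
    exact norm_mk_le ρA ρB _
  · rw [norm_mk ρA]
    refine le_ciInf fun i => ?_
    obtain ⟨l, hl, h1, h2⟩ := exists_tensor_approxUnit (𝔄 := 𝔄) (idealSubalgebra N) B
    have hmk : ∀ᶠ p in l, ‖mk (ρA.onIdeal N) ρB p‖ ≤ 1 :=
      h1.mono fun p hp => (norm_mk_le _ _ p).trans hp
    obtain ⟨hl', hr'⟩ := h2 (ρA.onIdeal N) ρB x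
    simp only [mk_mul] at hl' hr'
    have hlim := tendsto_mul_of_norm_le_one hmk hl' (tendsto_mul_of_norm_le_one hmk hl' hr')
    refine le_of_tendsto hlim.norm ?_
    filter_upwards [h1] with p hp
    -- Only a preimage `k` in `I_{N,B}` of the sandwiched `i` is needed: adding it leaves the class
    -- over `N` unchanged and turns `x` into `x + i` inside the product over `A`.
    obtain ⟨k, hk, hki⟩ := mul_moduleIdeal_mul_mem ρA ρB N i.2 p p p
    have h3 : mk (ρA.onIdeal N) ρB p * (mk (ρA.onIdeal N) ρB p * (mk (ρA.onIdeal N) ρB x *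
        mk (ρA.onIdeal N) ρB p)) = mk (ρA.onIdeal N) ρB (p * (p * (x * p)) + k) := by
      rw [map_add, mk_eq_zero _ _ hk, add_zero, mk_mul, mk_mul, mk_mul]
    have h4 : idealTensorIncl B N (p * (p * (x * p)) + k) =
        idealTensorIncl B N p * (idealTensorIncl B N p * (idealTensorIncl B N x + i)) *
          idealTensorIncl B N p := by
      simp only [map_add, idealTensorIncl_mul, hki, mul_add, add_mul, mul_assoc]
    rw [h3]
    refine (norm_mk_le _ _ _).trans ?_
    rw [← maxNorm_idealTensorIncl, h4]
    have hp' : maxNorm (idealTensorIncl B N p) ≤ 1 := (maxNorm_idealTensorIncl N p).trans_le hp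
    exact (maxNorm_mul_le _ _).trans <| (mul_le_of_le_one_right (maxNorm_nonneg _) hp').trans <|
      (maxNorm_mul_le _ _).trans <| (mul_le_of_le_one_left (maxNorm_nonneg _) hp').trans <|
      (maxNorm_mul_le _ _).trans <| mul_le_of_le_one_left (maxNorm_nonneg _) hp'

/-! ### The isometric `*`-homomorphism. -/

/-- The canonical `*`-homomorphism `N ⊗_{𝔄,max} B → A ⊗_{𝔄,max} B`, as a linear map. -/
def ModuleMaxTensor.idealInclL :
    ModuleMaxTensor (ρA.onIdeal N) ρB →L[ℂ] ModuleMaxTensor ρA ρB :=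
  (mk ρA ρB ∘ₗ idealTensorIncl B N).extendOfNorm (mk (ρA.onIdeal N) ρB)

/-- The equality of norms supplies the bound, with constant `1`, under which the extension by
density has the prescribed values. -/
lemma ModuleMaxTensor.idealInclL_mk (x : idealSubalgebra N ⊗[ℂ] B) :
    idealInclL ρA ρB N (mk (ρA.onIdeal N) ρB x) = mk ρA ρB (idealTensorIncl B N x) :=
  LinearMap.extendOfNorm_eq (denseRange_mk (ρA.onIdeal N) ρB)
    ⟨1, fun x => by simp [norm_mk_idealTensorIncl]⟩ x

/-- The canonical `*`-homomorphism `N ⊗_{𝔄,max} B → A ⊗_{𝔄,max} B`. -/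
def ModuleMaxTensor.idealIncl :
    ModuleMaxTensor (ρA.onIdeal N) ρB →⋆ₙₐ[ℂ] ModuleMaxTensor ρA ρB where
  toFun := idealInclL ρA ρB N
  map_smul' c x := map_smul (idealInclL ρA ρB N) c x
  map_zero' := map_zero (idealInclL ρA ρB N)
  map_add' := map_add (idealInclL ρA ρB N)
  map_mul' x y := by
    refine (denseRange_mk (ρA.onIdeal N) ρB).induction_on₂
      (p := fun x y => idealInclL ρA ρB N (x * y) = idealInclL ρA ρB N x * idealInclL ρA ρB N y)
      (isClosed_eq (by fun_prop) (by fun_prop)) (fun x y => ?_) x y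
    simp only [← mk_mul, idealInclL_mk, idealTensorIncl_mul]
  map_star' x := by
    refine (denseRange_mk (ρA.onIdeal N) ρB).induction_on
      (p := fun x => idealInclL ρA ρB N (star x) = star (idealInclL ρA ρB N x)) x
      (isClosed_eq (by fun_prop) (by fun_prop)) (fun x => ?_)
    simp only [← mk_star, idealInclL_mk, idealTensorIncl_star]

lemma ModuleMaxTensor.idealIncl_mk (x : idealSubalgebra N ⊗[ℂ] B) :
    idealIncl ρA ρB N (mk (ρA.onIdeal N) ρB x) = mk ρA ρB (idealTensorIncl B N x) :=
  idealInclL_mk ρA ρB N x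

lemma ModuleMaxTensor.isometry_idealIncl : Isometry (idealIncl ρA ρB N) := by
  refine AddMonoidHomClass.isometry_of_norm _ fun x => ?_
  refine (denseRange_mk (ρA.onIdeal N) ρB).induction_on
    (p := fun x => ‖idealInclL ρA ρB N x‖ = ‖x‖) x
    (isClosed_eq (by fun_prop) (by fun_prop)) (fun x => ?_)
  rw [idealInclL_mk, norm_mk_idealTensorIncl]

end IdealModuleTensor

end ModuleTensor

end

theorem mainTheorem10 {𝔄 : Type w} {A : Type u} [NonUnitalCStarAlgebra 𝔄]
    [NonUnitalCStarAlgebra A] (ρA : ModuleTensor.CompatibleAction 𝔄 A)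
    (N : Submodule ℂ A) [ModuleTensor.IsClosedIdeal N] :
    (∀ (B : Type v) [NonUnitalCStarAlgebra B] (ρB : ModuleTensor.CompatibleAction 𝔄 B),
      ∃ ι : ModuleTensor.ModuleMaxTensor (ρA.onIdeal N) ρB →⋆ₙₐ[ℂ]
          ModuleTensor.ModuleMaxTensor ρA ρB,
        Isometry ι ∧
        ∀ (n : ModuleTensor.idealSubalgebra N) (b : B),
          ι (ModuleTensor.ModuleMaxTensor.mk (ρA.onIdeal N) ρB (n ⊗ₜ[ℂ] b)) =
            ModuleTensor.ModuleMaxTensor.mk ρA ρB ((n : A) ⊗ₜ[ℂ] b)) ∧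
    ModuleTensor.IsModuleMaxInjective.{u, v, w} ρA (ModuleTensor.idealSubalgebra N)
      (ρA.invariant_ideal N) :=
  ⟨fun _ _ ρB => ⟨ModuleTensor.ModuleMaxTensor.idealIncl ρA ρB N,
      ModuleTensor.ModuleMaxTensor.isometry_idealIncl ρA ρB N,
      fun n b => ModuleTensor.ModuleMaxTensor.idealIncl_mk ρA ρB N (n ⊗ₜ[ℂ] b)⟩,
    -- `idealTensorIncl` is by definition the `rTensor` of the inclusion, and `onIdeal` is the
    -- restricted action, so the equality of norms is already max-injectivity.
    fun _ _ ρC x => (ModuleTensor.ModuleMaxTensor.norm_mk_idealTensorIncl ρA ρC N x).symm⟩
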